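/- **Conventions.** All graphs are finite, simple and undirected. $A(H)$ is the adjacency matrix of $H$, its eigenvalues with multiplicities form the $A$-spectrum, and two graphs on the same number of vertices are called *non-cospectral* if their $A$-spectra differ. $L^2(H)=L(L(H))$ is the line graph of the line graph of $H$. For a connected graph $X$ with distance $d$ and vertex eccentricities $e(v)=\max_w d(v,w)$, the *eccentricity matrix* $\epsilon(X)$ has $(u,v)$ entry $d(u,v)$ if $d(u,v)=\min\{e(u),e(v)\}$ and $0$ otherwise. Its eigenvalues with multiplicities form the $\epsilon$-spectrum, and the sum of their absolute values is the $\epsilon$-energy. Two graphs are *non-$\epsilon$-cospectral* if their $\epsilon$-spectra differ, and *$\epsilon$-equienergetic* if their $\epsilon$-energies are equal. The *central graph* $C[G]$ is obtained from $G$ by subdividing every edge once and joining all pairs of distinct vertices of $G$ that are not adjacent in $G$. The *central vertex join* $C[G]\,\dot\vee\,K$ is the disjoint union of $C[G]$ and $K$ together with all edges between the vertices of $G$ and the vertices of $K$. The *central edge join* $C[G]\,\veebar\,K$ is the disjoint union of $C[G]$ and $K$ together with all edges between the subdivision vertices of $C[G]$ and the vertices of $K$. **Statement.** Let $t\ge 3$,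 and let $H_1$ and $H_2$ be non-cospectral $3$-regular graphs, each with $2t$ vertices and $3t$ edges. Let $G$ be a regular triangle-free graph with at least one vertex. Then: 1. $C[G]\,\dot\vee\,L^2(H_1)$ and $C[G]\,\dot\vee\,L^2(H_2)$ are non-$\epsilon$-cospectral and $\epsilon$-equienergetic. 2. If moreover $G$ has at least one edge, then $C[G]\,\veebar\,L^2(H_1)$ and $C[G]\,\veebar\,L^2(H_2)$ are non-$\epsilon$-cospectral and $\epsilon$-equienergetic. -/

import Mathlib

namespace SimpleGraph

/-- The central graph `C[G]`: subdivide every edge of `G` once (the new vertices are indexed by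
`G.edgeSet`) and join all pairs of distinct vertices of `G` that are not adjacent in `G`. -/
def centralGraph {V : Type*} (G : SimpleGraph V) : SimpleGraph (V ⊕ G.edgeSet) where
  Adj
    | Sum.inl u, Sum.inl v => u ≠ v ∧ ¬ G.Adj u v
    | Sum.inl u, Sum.inr e => u ∈ (e : Sym2 V)
    | Sum.inr e, Sum.inl u => u ∈ (e : Sym2 V)
    | Sum.inr _, Sum.inr _ => False
  symm := ⟨by
    rintro (u | e) (v | f) h
    · exact ⟨h.1.symm, fun h' => h.2 h'.symm⟩
    · exact h
    · exact h
    · exact h⟩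
  loopless := ⟨by
    rintro (u | e) h
    · exact h.1 rfl
    · exact h⟩

/-- The central vertex join of `G` and `K`: the disjoint union of `C[G]` and `K`, with each vertex
of `G` joined to every vertex of `K`. -/
def centralVertexJoin {V W : Type*} (G : SimpleGraph V) (K : SimpleGraph W) :
    SimpleGraph ((V ⊕ G.edgeSet) ⊕ W) where
  Adj
    | Sum.inl a, Sum.inl b => G.centralGraph.Adj a b
    | Sum.inr x, Sum.inr y => K.Adj x y
    | Sum.inl (Sum.inl _), Sum.inr _ => True
    | Sum.inr _, Sum.inl (Sum.inl _) => True
    | Sum.inl (Sum.inr _), Sum.inr _ => False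
    | Sum.inr _, Sum.inl (Sum.inr _) => False
  symm := ⟨by
    rintro ((u | e) | x) ((v | f) | y) h
    all_goals first | exact h | exact h.symm⟩
  loopless := ⟨by
    rintro ((u | e) | x) h
    · exact G.centralGraph.irrefl h
    · exact G.centralGraph.irrefl h
    · exact K.irrefl h⟩

/-- The central edge join of `G` and `K`: the disjoint union of `C[G]` and `K`, with each
subdivision vertex of `C[G]` joined to every vertex of `K`. -/
def centralEdgeJoin {V W : Type*} (G : SimpleGraph V) (K : SimpleGraph W) :
    SimpleGraph ((V ⊕ G.edgeSet) ⊕ W) where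
  Adj
    | Sum.inl a, Sum.inl b => G.centralGraph.Adj a b
    | Sum.inr x, Sum.inr y => K.Adj x y
    | Sum.inl (Sum.inl _), Sum.inr _ => False
    | Sum.inr _, Sum.inl (Sum.inl _) => False
    | Sum.inl (Sum.inr _), Sum.inr _ => True
    | Sum.inr _, Sum.inl (Sum.inr _) => True
  symm := ⟨by
    rintro ((u | e) | x) ((v | f) | y) h
    all_goals first | exact h | exact h.symm⟩
  loopless := ⟨by
    rintro ((u | e) | x) h
    · exact G.centralGraph.irrefl h
    · exact G.centralGraph.irrefl h
    · exact K.irrefl h⟩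

open Classical in
/-- The eccentricity matrix of a connected finite graph: the entry at `(u, v)` is `d(u, v)` if
`d(u, v) = min (e(u)) (e(v))`, and `0` otherwise. -/
noncomputable def eccMatrix {V : Type*} (G : SimpleGraph V) : Matrix V V ℝ :=
  Matrix.of fun u v =>
    if G.edist u v = min (G.eccent u) (G.eccent v) then (G.dist u v : ℝ) else 0

open Classical in
/-- The adjacency spectrum: the multiset of eigenvalues of the adjacency matrix, with algebraic
multiplicities. -/
noncomputable def adjSpectrum {V : Type*} [Finite V] (G : SimpleGraph V) : Multiset ℝ :=
  letI := Fintype.ofFinite V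
  (G.adjMatrix ℝ).charpoly.roots

open Classical in
/-- The eccentricity spectrum: the multiset of eigenvalues of the eccentricity matrix, with
algebraic multiplicities (the matrix is real symmetric, so all its eigenvalues are real). -/
noncomputable def eccSpectrum {V : Type*} [Finite V] (G : SimpleGraph V) : Multiset ℝ :=
  letI := Fintype.ofFinite V
  G.eccMatrix.charpoly.roots

/-- The eccentricity energy: the sum of the absolute values of the eccentricity eigenvalues,
counted with multiplicity. -/
noncomputable def eccEnergy {V : Type*} [Finite V] (G : SimpleGraph V) : ℝ :=
  (G.eccSpectrum.map fun x => |x|).sum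

end SimpleGraph

/-! Both joins attach `K` to the vertices of a set `S` in `C[G]` (`coneJoin`). Collapsing `K` to one
apex preserves every distance except those inside `K`. The apex is within 2 of everything, so each
vertex of a regular non-complete `K` has eccentricity exactly 2. Hence `K` enters the eccentricity
matrix only through its own block `2J - 2A(K) - 2I` (`eccMatrix_coneJoin`).

The all-ones vector is an eigenvector of that block, so by a Schur complement the characteristic
polynomial is that of `-2A(K) - 2I` times a factor depending only on the order and degree of `K`.
Two such joins therefore differ only by exchanging the values `-2μ - 2`, for `μ` an eigenvalue of
`K` (`eccSpectrum_coneJoin_add`).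

For `K = L²(H)` with `H` cubic, `μ` runs over `λ + 3` for `λ` in the spectrum of `H`, over `0` and
over `-2`. Injectivity of the affine maps carries non-cospectrality across. Since `λ ≥ -3`, the
values `-2(λ + 3) - 2` are all negative, so the sum of absolute values depends only on the trace,
which is zero, and on `t`. -/

namespace SimpleGraph

/-! ### Distances and eccentricities in joins -/

/-- A map sending adjacent vertices to equal or adjacent vertices does not increase distances. -/
theorem edist_map_le {V V' : Type*} {G : SimpleGraph V} {G' : SimpleGraph V'} (f : V → V')
    (hf : ∀ a b, G.Adj a b → f a = f b ∨ G'.Adj (f a) (f b)) (a b : V) :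
    G'.edist (f a) (f b) ≤ G.edist a b := by
  have key : ∀ {a b : V} (p : G.Walk a b), G'.edist (f a) (f b) ≤ p.length := by
    intro a b p
    induction p with
    | nil => simp
    | @cons u v w h p ih =>
      have h1 : G'.edist (f u) (f v) ≤ 1 := by
        rw [edist_le_one_iff_adj_or_eq]
        exact (hf u v h).symm
      calc G'.edist (f u) (f w) ≤ G'.edist (f u) (f v) + G'.edist (f v) (f w) :=
            SimpleGraph.edist_triangle
        _ ≤ 1 + p.length := add_le_add h1 ih
        _ = _ := by rw [Walk.length_cons]; push_cast; rw [add_comm]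
  exact le_iInf key

/-- The disjoint union of `C` and `K`, with each vertex of `S` joined to every vertex of `K`. -/
def coneJoin {A W : Type*} (C : SimpleGraph A) (S : Set A) (K : SimpleGraph W) :
    SimpleGraph (A ⊕ W) where
  Adj
    | Sum.inl a, Sum.inl b => C.Adj a b
    | Sum.inr x, Sum.inr y => K.Adj x y
    | Sum.inl a, Sum.inr _ => a ∈ S
    | Sum.inr _, Sum.inl a => a ∈ S
  symm := ⟨by
    rintro (a | x) (b | y) h
    all_goals first | exact h | exact h.symm⟩
  loopless := ⟨by
    rintro (a | x) h
    · exact C.irrefl h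
    · exact K.irrefl h⟩

theorem centralVertexJoin_eq_coneJoin {V W : Type*} (G : SimpleGraph V) (K : SimpleGraph W) :
    G.centralVertexJoin K = G.centralGraph.coneJoin (Set.range Sum.inl) K := by
  ext ((u | e) | x) ((v | f) | y) <;> simp [centralVertexJoin, coneJoin]

theorem centralEdgeJoin_eq_coneJoin {V W : Type*} (G : SimpleGraph V) (K : SimpleGraph W) :
    G.centralEdgeJoin K = G.centralGraph.coneJoin (Set.range Sum.inr) K := by
  ext ((u | e) | x) ((v | f) | y) <;> simp [centralEdgeJoin, coneJoin]

/-- The cone over `S` in `C`: one new vertex joined to all vertices of `S`. -/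
abbrev cone {A : Type*} (C : SimpleGraph A) (S : Set A) : SimpleGraph (A ⊕ Unit) :=
  C.coneJoin S ⊥

section coneJoin

variable {A W : Type*} (C : SimpleGraph A) (S : Set A) (K : SimpleGraph W)

/-- Collapsing `K` to the apex contracts or preserves each edge. With the section in
`coneJoin_edist_le`, which sends the apex to any chosen `w`, this gives equality of distances
outside `K`. -/
theorem cone_edist_le (x y : A ⊕ W) :
    (C.cone S).edist (Sum.map id (fun _ => ()) x) (Sum.map id (fun _ => ()) y) ≤
      (C.coneJoin S K).edist x y := by
  refine edist_map_le _ ?_ x y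
  rintro (a | x) (b | y) h
  · exact Or.inr h
  · exact Or.inr h
  · exact Or.inr h
  · exact Or.inl rfl

theorem coneJoin_edist_le (w : W) (x y : A ⊕ Unit) :
    (C.coneJoin S K).edist (Sum.map id (fun _ => w) x) (Sum.map id (fun _ => w) y) ≤
      (C.cone S).edist x y := by
  refine edist_map_le _ ?_ x y
  rintro (a | x) (b | y) h
  · exact Or.inr h
  · exact Or.inr h
  · exact Or.inr h
  · exact Or.inl rfl

theorem coneJoin_edist_inl_inl [Nonempty W] (a b : A) :
    (C.coneJoin S K).edist (.inl a) (.inl b) = (C.cone S).edist (.inl a) (.inl b) :=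
  le_antisymm (coneJoin_edist_le C S K (Classical.arbitrary W) (.inl a) (.inl b))
    (cone_edist_le C S K (.inl a) (.inl b))

theorem coneJoin_edist_inl_inr (a : A) (w : W) :
    (C.coneJoin S K).edist (.inl a) (.inr w) = (C.cone S).edist (.inl a) (.inr ()) :=
  le_antisymm (coneJoin_edist_le C S K w (.inl a) (.inr ()))
    (cone_edist_le C S K (.inl a) (.inr w))

theorem coneJoin_eccent_inl [Nonempty W] (a : A) :
    (C.coneJoin S K).eccent (.inl a) = (C.cone S).eccent (.inl a) := by
  simp only [eccent_def, iSup_sum, coneJoin_edist_inl_inl, coneJoin_edist_inl_inr, ciSup_const]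

variable {C S K}

theorem coneJoin_edist_inr_le (hS : S.Nonempty) (w w' : W) :
    (C.coneJoin S K).edist (.inr w) (.inr w') ≤ 2 := by
  obtain ⟨s, hs⟩ := hS
  have h (v : W) : (C.coneJoin S K).edist (.inl s) (.inr v) ≤ 1 :=
    edist_le_one_iff_adj_or_eq.2 (Or.inl hs)
  calc _ ≤ (C.coneJoin S K).edist (.inr w) (.inl s) + (C.coneJoin S K).edist (.inl s) (.inr w') :=
        SimpleGraph.edist_triangle
    _ ≤ 1 + 1 := add_le_add (by rw [SimpleGraph.edist_comm]; exact h w) (h w')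
    _ = 2 := one_add_one_eq_two

theorem coneJoin_edist_inr_eq_two (hS : S.Nonempty) {w w' : W} (hne : w ≠ w')
    (hadj : ¬ K.Adj w w') : (C.coneJoin S K).edist (.inr w) (.inr w') = 2 := by
  obtain ⟨s, hs⟩ := hS
  exact edist_eq_two_iff.2 ⟨by simpa using hne, hadj, .inl s, hs, hs⟩

theorem coneJoin_eccent_inr (hS : S.Nonempty)
    (hC : ∀ a, (C.cone S).edist (.inl a) (.inr ()) ≤ 2) {w : W}
    (hw : ∃ w', w ≠ w' ∧ ¬ K.Adj w w') : (C.coneJoin S K).eccent (.inr w) = 2 := by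
  refine le_antisymm ((eccent_le_iff _ _).2 ?_) ?_
  · rintro (a | w')
    · rw [SimpleGraph.edist_comm, coneJoin_edist_inl_inr]
      exact hC a
    · exact coneJoin_edist_inr_le hS w w'
  · obtain ⟨w', hne, hadj⟩ := hw
    rw [← coneJoin_edist_inr_eq_two (C := C) hS hne hadj]
    exact edist_le_eccent

open Classical in
/-- The eccentricity matrix of a join of `C` and `K` over `S`: only one block depends on `K`. -/
theorem eccMatrix_coneJoin [Nonempty W] [DecidableEq W] [DecidableRel K.Adj] (hS : S.Nonempty)
    (hC : ∀ a, (C.cone S).edist (.inl a) (.inr ()) ≤ 2)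
    (hK : ∀ w, ∃ w', w ≠ w' ∧ ¬ K.Adj w w') :
    (C.coneJoin S K).eccMatrix = Matrix.fromBlocks
      (Matrix.of fun a b => (C.cone S).eccMatrix (.inl a) (.inl b))
      (Matrix.of fun a _ =>
        if (C.cone S).edist (.inl a) (.inr ()) = min ((C.cone S).eccent (.inl a)) 2 then
          ((C.cone S).dist (.inl a) (.inr ()) : ℝ) else 0)
      (Matrix.of fun _ a =>
        if (C.cone S).edist (.inl a) (.inr ()) = min ((C.cone S).eccent (.inl a)) 2 then
          ((C.cone S).dist (.inl a) (.inr ()) : ℝ) else 0)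
      ((2 : ℝ) • (Matrix.of fun _ _ => 1) + ((-2 : ℝ) • K.adjMatrix ℝ + (-2 : ℝ) • 1)) := by
  ext (a | w) (b | w')
  · simp [eccMatrix, coneJoin_edist_inl_inl, coneJoin_eccent_inl, dist]
  · simp [eccMatrix, coneJoin_edist_inl_inr, coneJoin_eccent_inl, coneJoin_eccent_inr hS hC (hK _),
      dist]
  · simp [eccMatrix, SimpleGraph.edist_comm (v := Sum.inl b), coneJoin_edist_inl_inr,
      coneJoin_eccent_inl, coneJoin_eccent_inr hS hC (hK _), dist, min_comm]
  · simp only [eccMatrix, coneJoin_eccent_inr hS hC (hK _), dist, Matrix.of_apply, min_self,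
      Matrix.fromBlocks_apply₂₂, Matrix.smul_apply, Matrix.add_apply,
      adjMatrix_apply, smul_eq_mul]
    by_cases hne : w = w'
    · subst hne
      simp
    by_cases hadj : K.Adj w w'
    · have h : (C.coneJoin S K).edist (.inr w) (.inr w') = 1 := edist_eq_one_iff_adj.2 hadj
      simp [h, hadj, hne]
    · have h := coneJoin_edist_inr_eq_two (C := C) hS hne hadj
      simp [h, hadj, hne]

end coneJoin

theorem cone_centralGraph_range_inl_edist_le {V : Type*} (G : SimpleGraph V) (a : V ⊕ G.edgeSet) :
    (G.centralGraph.cone (Set.range Sum.inl)).edist (.inl a) (.inr ()) ≤ 2 := by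
  rcases a with u | ⟨e, he⟩
  · refine le_trans (edist_le_one_iff_adj_or_eq.2 (Or.inl ?_)) one_le_two
    exact ⟨u, rfl⟩
  · refine (edist_eq_two_iff.2 ⟨by simp, by simp [coneJoin], ?_⟩).le
    induction e with | _ u v =>
    exact ⟨.inl (.inl u), Sym2.mem_mk_left u v, ⟨u, rfl⟩⟩

theorem cone_centralGraph_range_inr_edist_le {V : Type*} (G : SimpleGraph V)
    (hG : ∀ u, ∃ v, G.Adj u v) (a : V ⊕ G.edgeSet) :
    (G.centralGraph.cone (Set.range Sum.inr)).edist (.inl a) (.inr ()) ≤ 2 := by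
  rcases a with u | e
  · refine (edist_eq_two_iff.2 ⟨by simp, by simp [coneJoin], ?_⟩).le
    obtain ⟨v, h⟩ := hG u
    exact ⟨.inl (.inr ⟨s(u, v), h⟩), Sym2.mem_mk_left u v, ⟨_, rfl⟩⟩
  · refine le_trans (edist_le_one_iff_adj_or_eq.2 (Or.inl ?_)) one_le_two
    exact ⟨e, rfl⟩

end SimpleGraph

/-! ### Characteristic polynomials of block matrices -/

namespace Matrix

open Polynomial

variable {m n : Type*} [Fintype m] [Fintype n] [DecidableEq m] [DecidableEq n]

theorem inv_mulVec_of_mulVec_eq_smul {D : Matrix n n ℝ} (hD : IsUnit D.det) {d : ℝ} (hd : d ≠ 0)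
    {v : n → ℝ} (h : D *ᵥ v = d • v) : D⁻¹ *ᵥ v = d⁻¹ • v := by
  have h1 : D⁻¹ *ᵥ (D *ᵥ v) = v := by
    rw [mulVec_mulVec, nonsing_inv_mul _ hD, one_mulVec]
  rw [h, mulVec_smul] at h1
  rw [eq_inv_smul_iff₀ hd, h1]

/-- The determinant after subtracting a multiple of the all-ones matrix. -/
theorem det_sub_smul_one_of_mulVec {D : Matrix n n ℝ} (hD : IsUnit D.det) {d : ℝ} (hd : d ≠ 0)
    (h : D *ᵥ (fun _ => 1) = d • fun _ => (1 : ℝ)) (s : ℝ) :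
    (D - s • of fun _ _ => (1 : ℝ)).det = D.det * (1 - s * (Fintype.card n / d)) := by
  have e : D - s • (of fun _ _ => (1 : ℝ)) =
      D + replicateCol Unit (fun _ => -s) * replicateRow Unit (fun _ : n => (1 : ℝ)) := by
    ext i j
    simp [sub_eq_add_neg, mul_apply]
  rw [e, det_add_replicateCol_mul_replicateRow hD, det_unique (n := Unit)]
  congr 1
  have h2 := inv_mulVec_of_mulVec_eq_smul hD hd h
  have h3 : (fun _ : n => -s) = (-s) • fun _ => (1 : ℝ) := by ext; simp
  rw [add_apply, Matrix.mul_assoc, ← replicateCol_mulVec, h3, mulVec_smul, h2,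
    replicateRow_mul_replicateCol_apply]
  simp [dotProduct]
  ring

/-- Schur complement with respect to a block having the all-ones vector as an eigenvector. -/
theorem det_fromBlocks_of_mulVec (P : Matrix m m ℝ) (q : m → ℝ) {D : Matrix n n ℝ}
    (hD : IsUnit D.det) {d : ℝ} (hd : d ≠ 0)
    (h : D *ᵥ (fun _ => 1) = d • fun _ => (1 : ℝ)) :
    (fromBlocks P (of fun a _ => q a) (of fun _ a => q a) D).det =
      D.det * (P - (Fintype.card n / d : ℝ) • vecMulVec q q).det := by
  have : Invertible D := invertibleOfIsUnitDet D hD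
  rw [det_fromBlocks₂₂, invOf_eq_nonsing_inv]
  congr 3
  have h2 := inv_mulVec_of_mulVec_eq_smul hD hd h
  have e1 : (of fun a _ => q a : Matrix m n ℝ) = vecMulVec q (fun _ => 1) := by
    ext; simp [vecMulVec_apply]
  have e2 : (of fun _ a => q a : Matrix n m ℝ) = vecMulVec (fun _ => 1) q := by
    ext; simp [vecMulVec_apply]
  rw [e1, e2, Matrix.mul_assoc, mul_vecMulVec, h2, vecMulVec_mul_vecMulVec]
  ext i j
  simp [vecMulVec_apply, dotProduct]
  ring

/-- The right-hand side sees `B` only through its characteristic polynomial, its row sum `b` and its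
size. The excluded `x` are those where `x - B` or `x - B - sJ` could be singular; `b + s * card n`
is the eigenvalue of `sJ + B` at the all-ones vector. -/
theorem eval_charpoly_fromBlocks (P : Matrix m m ℝ) (q : m → ℝ) (s : ℝ) {b : ℝ}
    {B : Matrix n n ℝ} (h : B *ᵥ (fun _ => 1) = b • fun _ => (1 : ℝ)) {x : ℝ}
    (hB : B.charpoly.eval x ≠ 0) (hb : x ≠ b) (hc : x ≠ b + s * Fintype.card n) :
    (fromBlocks P (of fun a _ => q a) (of fun _ a => q a)
        (s • (of fun _ _ => 1) + B)).charpoly.eval x =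
      B.charpoly.eval x * ((1 - s * (Fintype.card n / (x - b))) *
        (scalar m x - P -
          (Fintype.card n / (x - (b + s * Fintype.card n)) : ℝ) • vecMulVec q q).det) := by
  have hb' : x - b ≠ 0 := sub_ne_zero.2 hb
  have hc' : x - (b + s * Fintype.card n) ≠ 0 := sub_ne_zero.2 hc
  have hx (x : ℝ) : scalar n x *ᵥ (fun _ => 1) = x • fun _ => (1 : ℝ) := by
    rw [scalar_apply, ← smul_one_eq_diagonal, smul_mulVec, one_mulVec]
  have hJ : (of fun _ _ => 1 : Matrix n n ℝ) *ᵥ (fun _ => 1) =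
      (Fintype.card n : ℝ) • fun _ => (1 : ℝ) := by
    ext; simp [mulVec, dotProduct]
  have hD : (scalar n x - B) *ᵥ (fun _ => 1) = (x - b) • fun _ => (1 : ℝ) := by
    rw [sub_mulVec, h, hx, sub_smul]
  have hN : (scalar n x - B - s • of fun _ _ => 1) *ᵥ (fun _ => 1) =
      (x - (b + s * Fintype.card n)) • fun _ => (1 : ℝ) := by
    rw [sub_mulVec, hD, smul_mulVec, hJ, smul_smul, ← sub_smul, sub_sub]
  rw [eval_charpoly] at hB
  have hdet := det_sub_smul_one_of_mulVec (isUnit_iff_ne_zero.2 hB) hb' hD s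
  have hunit : IsUnit (scalar n x - B - s • of fun _ _ => (1 : ℝ)).det := by
    rw [hdet, isUnit_iff_ne_zero]
    refine mul_ne_zero hB fun h0 => hc' ?_
    field_simp at h0
    linarith
  have e : scalar (m ⊕ n) x - fromBlocks P (of fun a _ => q a) (of fun _ a => q a)
        (s • (of fun _ _ => 1) + B) =
      fromBlocks (scalar m x - P) (of fun a _ => (-q) a) (of fun _ a => (-q) a)
        (scalar n x - B - s • of fun _ _ => 1) := by
    ext (i | i) (j | j)
    · simp [diagonal_apply]
    · simp
    · simp
    · simp [diagonal_apply]
      ring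
  rw [eval_charpoly, eval_charpoly, e, det_fromBlocks_of_mulVec _ _ hunit hc' hN, hdet,
    neg_vecMulVec, vecMulVec_neg, neg_neg, mul_assoc]

/-- Two block matrices differing only in a block `s J + B` (with constant row sums) have
characteristic polynomials in the same ratio as those of the blocks `B`. -/
theorem charpoly_fromBlocks_mul_charpoly {n₁ n₂ : Type*} [Fintype n₁] [Fintype n₂]
    [DecidableEq n₁] [DecidableEq n₂] (P : Matrix m m ℝ) (q : m → ℝ) (s b : ℝ)
    {B₁ : Matrix n₁ n₁ ℝ} {B₂ : Matrix n₂ n₂ ℝ} (hcard : Fintype.card n₁ = Fintype.card n₂)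
    (h₁ : B₁ *ᵥ (fun _ => 1) = b • fun _ => (1 : ℝ))
    (h₂ : B₂ *ᵥ (fun _ => 1) = b • fun _ => (1 : ℝ)) :
    (fromBlocks P (of fun a _ => q a) (of fun _ a => q a)
        (s • (of fun _ _ => 1) + B₁)).charpoly * B₂.charpoly =
      (fromBlocks P (of fun a _ => q a) (of fun _ a => q a)
        (s • (of fun _ _ => 1) + B₂)).charpoly * B₁.charpoly := by
  -- The pointwise formula fails at finitely many `x` only, which is enough for a polynomial
  -- identity.
  refine eq_of_infinite_eval_eq _ _ (Set.Infinite.mono ?_ (Set.Finite.infinite_compl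
    (s := ({b, b + s * Fintype.card n₁} ∪ {x | B₁.charpoly.IsRoot x}) ∪
      {x | B₂.charpoly.IsRoot x}) ?_))
  · intro x hx
    simp only [Set.mem_compl_iff, Set.mem_union, Set.mem_insert_iff, Set.mem_singleton_iff,
      Set.mem_ofPred_eq, not_or, IsRoot.def] at hx
    obtain ⟨⟨⟨hb, hc⟩, hx₁⟩, hx₂⟩ := hx
    rw [Set.mem_ofPred_eq, eval_mul, eval_mul, eval_charpoly_fromBlocks P q s h₁ hx₁ hb hc,
      eval_charpoly_fromBlocks P q s h₂ hx₂ hb (hcard ▸ hc), hcard]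
    ring
  · exact ((Set.toFinite _).union (finite_setOfPred_isRoot B₁.charpoly_monic.ne_zero)).union
      (finite_setOfPred_isRoot B₂.charpoly_monic.ne_zero)

/-- The eigenvalues of an affine function of a symmetric matrix. -/
theorem IsHermitian.roots_charpoly_smul_add_smul {A : Matrix n n ℝ} (hA : A.IsHermitian)
    (a b : ℝ) : (a • A + b • 1).charpoly.roots = A.charpoly.roots.map (fun x => a * x + b) := by
  have h : a • A + b • 1 = cfc (fun x : ℝ => a * x + b) A := by
    have hA' : IsSelfAdjoint A := hA
    rw [cfc_add .., cfc_const_mul .., cfc_id' ℝ A, cfc_const b A, Algebra.algebraMap_eq_smul_one]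
  rw [h, hA.charpoly_cfc_eq, hA.roots_charpoly_eq_eigenvalues, Polynomial.roots_prod]
  · simp only [RCLike.ofReal_real_eq_id, id_eq, roots_X_sub_C, Multiset.bind_singleton,
      Multiset.map_map]
    rfl
  · exact Finset.prod_ne_zero_iff.2 fun i _ => X_sub_C_ne_zero _

/-- `AB` and `BA` have the same nonzero eigenvalues; padding both sides with zeros avoids comparing
the sizes. -/
theorem roots_charpoly_mul_comm' (A : Matrix m n ℝ) (B : Matrix n m ℝ) :
    Multiset.replicate (Fintype.card n) 0 + (A * B).charpoly.roots =
      Multiset.replicate (Fintype.card m) 0 + (B * A).charpoly.roots := by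
  have h := congrArg roots (charpoly_mul_comm' A B)
  rwa [roots_mul (mul_ne_zero (pow_ne_zero _ X_ne_zero) (charpoly_monic _).ne_zero),
    roots_mul (mul_ne_zero (pow_ne_zero _ X_ne_zero) (charpoly_monic _).ne_zero),
    roots_X_pow, roots_X_pow, Multiset.nsmul_singleton, Multiset.nsmul_singleton] at h

end Matrix

/-! ### Incidence matrices and spectra of line graphs -/

namespace SimpleGraph

open scoped Matrix

section lineGraph

variable {V : Type*} [Fintype V] [DecidableEq V] (G : SimpleGraph V) [DecidableRel G.Adj]

/-- The vertex-edge incidence matrix with columns indexed by the edges. -/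
def edgeIncMatrix : Matrix V G.edgeSet ℝ := (G.incMatrix ℝ).submatrix id Subtype.val

theorem edgeIncMatrix_mulVec_one [Fintype G.edgeSet] (a : V) : (G.edgeIncMatrix *ᵥ fun _ => 1) a = G.degree a := by
  rw [← sum_incMatrix_apply (R := ℝ) G]
  simp only [Matrix.mulVec, dotProduct, mul_one]
  refine Fintype.sum_of_injective Subtype.val Subtype.val_injective _ _ (fun e he => ?_)
    fun _ => rfl
  exact G.incMatrix_of_notMem_incidenceSet fun h => he ⟨⟨e, h.1⟩, rfl⟩

theorem edgeIncMatrix_transpose_mulVec_one (e : G.edgeSet) :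
    (G.edgeIncMatrix.transpose *ᵥ fun _ => 1) e = 2 := by
  rw [← G.sum_incMatrix_apply_of_mem_edgeSet (R := ℝ) e.2]
  simp [Matrix.mulVec, dotProduct, edgeIncMatrix]

theorem edgeIncMatrix_mul_transpose [Fintype G.edgeSet] {r : ℕ} (hG : G.IsRegularOfDegree r) :
    G.edgeIncMatrix * G.edgeIncMatrix.transpose = (1 : ℝ) • G.adjMatrix ℝ + (r : ℝ) • 1 := by
  have h : G.edgeIncMatrix * G.edgeIncMatrix.transpose =
      G.incMatrix ℝ * (G.incMatrix ℝ).transpose := by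
    ext a b
    rw [Matrix.mul_apply, Matrix.mul_apply]
    refine Fintype.sum_of_injective Subtype.val Subtype.val_injective _ _ (fun e he => ?_)
      fun _ => rfl
    rw [G.incMatrix_of_notMem_incidenceSet fun h => he ⟨⟨e, h.1⟩, rfl⟩, zero_mul]
  rw [h, incMatrix_mul_transpose]
  ext a b
  by_cases hab : a = b
  · subst hab
    simp [hG a]
  · simp [hab]

variable [DecidableEq G.edgeSet] [DecidableRel G.lineGraph.Adj]

theorem edgeIncMatrix_transpose_mul :
    G.edgeIncMatrix.transpose * G.edgeIncMatrix =
      (1 : ℝ) • G.lineGraph.adjMatrix ℝ + (2 : ℝ) • 1 := by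
  ext e f
  by_cases hef : e = f
  · subst hef
    have h := G.incMatrix_transpose_mul_diag (R := ℝ) (e := e)
    rw [if_pos e.2] at h
    rw [Matrix.add_apply, Matrix.smul_apply, Matrix.smul_apply, Matrix.one_apply_eq]
    simpa [edgeIncMatrix, Matrix.mul_apply] using h
  have hR (v : V) (e : G.edgeSet) : G.edgeIncMatrix v e = if v ∈ (e : Sym2 V) then 1 else 0 := by
    simp [edgeIncMatrix, incMatrix_apply', incidenceSet]
  simp only [Matrix.mul_apply, Matrix.transpose_apply, hR, ← ite_and, mul_ite, mul_one, mul_zero]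
  -- Distinct edges share at most one vertex, so the off-diagonal sum is 0 or 1.
  by_cases hadj : G.lineGraph.Adj e f
  · obtain ⟨-, v, hve, hvf⟩ := lineGraph_adj_iff_exists.1 hadj
    rw [Finset.sum_eq_single v]
    · simp [hve, hvf, hadj, hef]
    · intro u _ huv
      rw [if_neg]
      rintro ⟨h1, h2⟩
      refine hef (Subtype.ext ?_)
      first
      | exact Sym2.eq_of_ne_mem huv h1 hve h2 hvf
      | exact Sym2.eq_of_ne_mem huv h2 hve h1 hvf
    · simp
  · rw [Finset.sum_eq_zero]
    · simp [hadj, hef]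
    · intro v _
      rw [if_neg]
      rintro ⟨h1, h2⟩
      exact hadj (lineGraph_adj_iff_exists.2 ⟨hef, v, by assumption, by assumption⟩)

theorem degree_lineGraph_add_two [Fintype G.edgeSet] {r : ℕ} (hG : G.IsRegularOfDegree r) (e : G.edgeSet) :
    G.lineGraph.degree e + 2 = 2 * r := by
  have h := congrArg (fun M => (M *ᵥ fun _ => (1 : ℝ)) e) G.edgeIncMatrix_transpose_mul
  have h1 : (G.edgeIncMatrix *ᵥ fun _ => 1) = (r : ℝ) • fun _ => (1 : ℝ) := by
    ext a
    simp [edgeIncMatrix_mulVec_one, hG a]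
  simp only [← Matrix.mulVec_mulVec, h1, Matrix.mulVec_smul, Matrix.add_mulVec, Matrix.smul_mulVec,
    Matrix.one_mulVec, Pi.smul_apply, Pi.add_apply, edgeIncMatrix_transpose_mulVec_one, one_smul,
    smul_eq_mul, mul_one] at h
  have h2 : (G.lineGraph.adjMatrix ℝ *ᵥ fun _ => 1) e = G.lineGraph.degree e := by
    simp
  rw [h2] at h
  have : ((G.lineGraph.degree e + 2 : ℕ) : ℝ) = (2 * r : ℕ) := by
    push_cast
    linarith
  exact_mod_cast this

end lineGraph

theorem adjSpectrum_eq_roots_charpoly {V : Type*} [Fintype V] [DecidableEq V] (G : SimpleGraph V)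
    [DecidableRel G.Adj] : G.adjSpectrum = (G.adjMatrix ℝ).charpoly.roots := by
  unfold adjSpectrum
  convert rfl

theorem eccSpectrum_eq_roots_charpoly {V : Type*} [Fintype V] [DecidableEq V]
    (G : SimpleGraph V) : G.eccSpectrum = G.eccMatrix.charpoly.roots := by
  unfold eccSpectrum
  convert rfl

section spectrum

variable {V : Type*} [Fintype V] (G : SimpleGraph V)

theorem sum_adjSpectrum : G.adjSpectrum.sum = 0 := by
  classical
  rw [adjSpectrum_eq_roots_charpoly,
    ← Matrix.trace_eq_sum_roots_charpoly_of_splits (isHermitian_adjMatrix ℝ G).splits_charpoly,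
    trace_adjMatrix]

theorem card_adjSpectrum : G.adjSpectrum.card = Fintype.card V := by
  classical
  rw [adjSpectrum_eq_roots_charpoly, (isHermitian_adjMatrix ℝ G).roots_charpoly_eq_eigenvalues]
  simp

variable [DecidableRel G.Adj] {r : ℕ}

/-- `A + rI = RRᵀ` is positive semidefinite, where `R` is the incidence matrix. -/
theorem neg_le_of_mem_adjSpectrum (hG : G.IsRegularOfDegree r) {x : ℝ} (hx : x ∈ G.adjSpectrum) :
    -(r : ℝ) ≤ x := by
  classical
  have hpsd : (G.edgeIncMatrix * G.edgeIncMatrix.transpose).PosSemidef := by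
    simpa using Matrix.posSemidef_self_mul_conjTranspose G.edgeIncMatrix
  rw [edgeIncMatrix_mul_transpose G hG] at hpsd
  have hmem : 1 * x + (r : ℝ) ∈ ((1 : ℝ) • G.adjMatrix ℝ + (r : ℝ) • 1).charpoly.roots := by
    rw [(isHermitian_adjMatrix ℝ G).roots_charpoly_smul_add_smul, ← adjSpectrum_eq_roots_charpoly]
    exact Multiset.mem_map_of_mem _ hx
  rw [hpsd.1.roots_charpoly_eq_eigenvalues, Multiset.mem_map] at hmem
  obtain ⟨i, -, hi⟩ := hmem
  have h0 := hpsd.eigenvalues_nonneg i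
  have : hpsd.1.eigenvalues i = 1 * x + r := hi
  linarith

/-- The spectrum of the line graph of a regular graph with `k` more edges than vertices. -/
theorem adjSpectrum_lineGraph (hG : G.IsRegularOfDegree r) {k : ℕ}
    (hk : G.edgeSet.ncard = Fintype.card V + k) :
    G.lineGraph.adjSpectrum =
      G.adjSpectrum.map (fun x => x + (r - 2 : ℝ)) + Multiset.replicate k (-2) := by
  classical
  -- Cancelling `card V` zeros leaves `k` of them in the spectrum of `RᵀR = A(L(G)) + 2I`; they
  -- become the eigenvalues `-2`.
  have h := Matrix.roots_charpoly_mul_comm' G.edgeIncMatrix G.edgeIncMatrix.transpose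
  rw [← Nat.card_coe_set_eq, Nat.card_eq_fintype_card] at hk
  rw [edgeIncMatrix_mul_transpose G hG, edgeIncMatrix_transpose_mul,
    (isHermitian_adjMatrix ℝ G).roots_charpoly_smul_add_smul,
    (isHermitian_adjMatrix ℝ G.lineGraph).roots_charpoly_smul_add_smul,
    ← adjSpectrum_eq_roots_charpoly, ← adjSpectrum_eq_roots_charpoly, hk, Multiset.replicate_add,
    add_assoc, add_right_inj] at h
  have h' := congrArg (Multiset.map fun x => x - 2) h
  simp only [Multiset.map_add, Multiset.map_map, Function.comp_def, one_mul,
    add_sub_cancel_right, Multiset.map_id', Multiset.map_replicate, zero_sub] at h'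
  rw [← h', add_comm]
  simp only [add_sub_assoc]

theorem card_mul_eq_two_mul_ncard_edgeSet (hG : G.IsRegularOfDegree r) :
    Fintype.card V * r = 2 * G.edgeSet.ncard := by
  classical
  have h := G.sum_degrees_eq_twice_card_edges
  simp only [hG.degree_eq, Finset.sum_const, Finset.card_univ, smul_eq_mul] at h
  rw [h, ← coe_edgeFinset, Set.ncard_coe_finset]

theorem exists_ne_not_adj (hG : G.IsRegularOfDegree r) (hr : r + 1 < Fintype.card V) (w : V) :
    ∃ w', w ≠ w' ∧ ¬ G.Adj w w' := by
  classical
  by_contra! h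
  have : G.neighborFinset w = Finset.univ.erase w := by
    ext v
    simp only [mem_neighborFinset, Finset.mem_erase, Finset.mem_univ, and_true]
    exact ⟨fun hv => hv.ne', fun hv => h v hv.symm⟩
  have h2 := hG w
  rw [degree, this, Finset.card_erase_of_mem (Finset.mem_univ _), Finset.card_univ] at h2
  omega

end spectrum

/-! ### Comparison of two joins -/

theorem neg_two_smul_adjMatrix_add_mulVec_one {W : Type*} [Fintype W] [DecidableEq W]
    {K : SimpleGraph W} [DecidableRel K.Adj] {k : ℕ} (hK : K.IsRegularOfDegree k) :
    ((-2 : ℝ) • K.adjMatrix ℝ + (-2 : ℝ) • 1) *ᵥ (fun _ => 1) =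
      (-2 * k + -2 : ℝ) • fun _ => (1 : ℝ) := by
  have h : (K.adjMatrix ℝ *ᵥ fun _ => 1) = (k : ℝ) • fun _ => (1 : ℝ) := by
    ext v
    simpa using K.adjMatrix_mulVec_const_apply_of_regular (a := (1 : ℝ)) (v := v) hK
  rw [Matrix.add_mulVec, Matrix.smul_mulVec, Matrix.smul_mulVec, Matrix.one_mulVec, h, smul_smul,
    ← add_smul]

/-- For joins of `C` with two regular graphs of the same order and degree, the eccentricity spectra
differ exactly by the images of the adjacency spectra. -/
theorem eccSpectrum_coneJoin_add {A W₁ W₂ : Type*} [Finite A] [Fintype W₁] [Fintype W₂]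
    {C : SimpleGraph A} {S : Set A} (hS : S.Nonempty)
    (hC : ∀ a, (C.cone S).edist (.inl a) (.inr ()) ≤ 2)
    (K₁ : SimpleGraph W₁) (K₂ : SimpleGraph W₂) [DecidableRel K₁.Adj] [DecidableRel K₂.Adj] {k : ℕ}
    (h₁ : K₁.IsRegularOfDegree k) (h₂ : K₂.IsRegularOfDegree k)
    (hcard : Fintype.card W₁ = Fintype.card W₂) (hk : k + 1 < Fintype.card W₁) :
    (C.coneJoin S K₁).eccSpectrum + K₂.adjSpectrum.map (fun x => -2 * x + -2) =
      (C.coneJoin S K₂).eccSpectrum + K₁.adjSpectrum.map (fun x => -2 * x + -2) := by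
  classical
  have := Fintype.ofFinite A
  have : Nonempty W₁ := Fintype.card_pos_iff.1 (by omega)
  have : Nonempty W₂ := Fintype.card_pos_iff.1 (by omega)
  rw [adjSpectrum_eq_roots_charpoly, adjSpectrum_eq_roots_charpoly, eccSpectrum_eq_roots_charpoly,
    eccSpectrum_eq_roots_charpoly, eccMatrix_coneJoin hS hC (K₁.exists_ne_not_adj h₁ hk),
    eccMatrix_coneJoin hS hC (K₂.exists_ne_not_adj h₂ (hcard ▸ hk)),
    ← (isHermitian_adjMatrix ℝ K₁).roots_charpoly_smul_add_smul,
    ← (isHermitian_adjMatrix ℝ K₂).roots_charpoly_smul_add_smul,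
    ← Polynomial.roots_mul (mul_ne_zero (Matrix.charpoly_monic _).ne_zero
      (Matrix.charpoly_monic _).ne_zero),
    ← Polynomial.roots_mul (mul_ne_zero (Matrix.charpoly_monic _).ne_zero
      (Matrix.charpoly_monic _).ne_zero),
    Matrix.charpoly_fromBlocks_mul_charpoly _ _ 2 (-2 * k + -2) hcard
      (neg_two_smul_adjMatrix_add_mulVec_one h₁) (neg_two_smul_adjMatrix_add_mulVec_one h₂)]

/-! ### Iterated line graphs of cubic graphs -/

section cubic

variable {W : Type*} [Fintype W] (H : SimpleGraph W) [DecidableRel H.Adj] {t : ℕ}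

theorem IsRegularOfDegree.lineGraph [DecidableEq W] [Fintype H.edgeSet] [DecidableEq H.edgeSet]
    [DecidableRel H.lineGraph.Adj] {r : ℕ} (hH : H.IsRegularOfDegree r) :
    H.lineGraph.IsRegularOfDegree (2 * r - 2) := fun e => by
  have := H.degree_lineGraph_add_two hH e
  omega

/-- The spectrum of the second iterated line graph of a cubic graph. -/
theorem adjSpectrum_lineGraph_lineGraph (hH : H.IsRegularOfDegree 3)
    (hW : Fintype.card W = 2 * t) (hE : H.edgeSet.ncard = 3 * t) :
    H.lineGraph.lineGraph.adjSpectrum = H.adjSpectrum.map (fun x => x + 3) +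
      (Multiset.replicate t 0 + Multiset.replicate (3 * t) (-2)) := by
  classical
  have hL := IsRegularOfDegree.lineGraph H hH
  have hcL : Fintype.card H.edgeSet = 3 * t := by
    rw [← hE, ← Nat.card_coe_set_eq, Nat.card_eq_fintype_card]
  have hEL := H.lineGraph.card_mul_eq_two_mul_ncard_edgeSet hL
  rw [hcL] at hEL
  rw [H.lineGraph.adjSpectrum_lineGraph hL (k := 3 * t) (by omega),
    H.adjSpectrum_lineGraph hH (k := t) (by omega), Multiset.map_add, Multiset.map_map,
    Multiset.map_replicate, add_assoc]
  congr 1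
  · refine Multiset.map_congr rfl fun x _ => ?_
    norm_num
    ring
  · norm_num

/-- No sign change occurs on the shifted spectrum of `H`: there the absolute value is `2λ + 8`,
contributing `16t` because the `λ` sum to zero. The eigenvalues `0` and `-2` contribute `2t` and
`6t`. -/
theorem sum_abs_adjSpectrum_lineGraph_lineGraph (hH : H.IsRegularOfDegree 3)
    (hW : Fintype.card W = 2 * t) (hE : H.edgeSet.ncard = 3 * t) :
    ((H.lineGraph.lineGraph.adjSpectrum.map fun x : ℝ => -2 * x + -2).map fun x => |x|).sum =
      (24 * t : ℝ) := by
  have h : (H.adjSpectrum.map fun x : ℝ => |-2 * (x + 3) + -2|) =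
      H.adjSpectrum.map fun x : ℝ => 2 * x + 8 := by
    refine Multiset.map_congr rfl fun x hx => ?_
    have := H.neg_le_of_mem_adjSpectrum hH hx
    push_cast at this
    rw [abs_of_nonpos (by linarith)]
    ring
  rw [H.adjSpectrum_lineGraph_lineGraph hH hW hE]
  have hsum : (H.adjSpectrum.map fun x : ℝ => 2 * x).sum = 0 := by
    rw [Multiset.sum_map_mul_left (f := fun x : ℝ => x), Multiset.map_id', sum_adjSpectrum,
      mul_zero]
  simp only [Multiset.map_add, Multiset.map_map, Function.comp_def, h, Multiset.sum_add,
    Multiset.map_replicate, Multiset.sum_replicate, Multiset.sum_map_add, hsum,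
    Multiset.map_const', card_adjSpectrum, hW, nsmul_eq_mul]
  norm_num
  ring

end cubic

theorem eccSpectrum_ne_and_eccEnergy_eq {A W₁ W₂ : Type*} [Finite A] [Fintype W₁] [Fintype W₂]
    {C : SimpleGraph A} {S : Set A} (hS : S.Nonempty)
    (hC : ∀ a, (C.cone S).edist (.inl a) (.inr ()) ≤ 2)
    (H₁ : SimpleGraph W₁) (H₂ : SimpleGraph W₂) [DecidableRel H₁.Adj] [DecidableRel H₂.Adj]
    {t : ℕ} (ht : 3 ≤ t)
    (hV₁ : Fintype.card W₁ = 2 * t) (hE₁ : H₁.edgeSet.ncard = 3 * t)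
    (hV₂ : Fintype.card W₂ = 2 * t) (hE₂ : H₂.edgeSet.ncard = 3 * t)
    (hH₁ : H₁.IsRegularOfDegree 3) (hH₂ : H₂.IsRegularOfDegree 3)
    (hne : H₁.adjSpectrum ≠ H₂.adjSpectrum) :
    (C.coneJoin S H₁.lineGraph.lineGraph).eccSpectrum ≠
        (C.coneJoin S H₂.lineGraph.lineGraph).eccSpectrum ∧
      (C.coneJoin S H₁.lineGraph.lineGraph).eccEnergy =
        (C.coneJoin S H₂.lineGraph.lineGraph).eccEnergy := by
  classical
  have hL₁ := IsRegularOfDegree.lineGraph H₁ hH₁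
  have hL₂ := IsRegularOfDegree.lineGraph H₂ hH₂
  have hcard₁ : Fintype.card H₁.lineGraph.edgeSet = 6 * t := by
    have h := H₁.lineGraph.card_mul_eq_two_mul_ncard_edgeSet hL₁
    rw [← Nat.card_eq_fintype_card, Nat.card_coe_set_eq, hE₁] at h
    rw [← Nat.card_eq_fintype_card, Nat.card_coe_set_eq]
    omega
  have hcard₂ : Fintype.card H₂.lineGraph.edgeSet = 6 * t := by
    have h := H₂.lineGraph.card_mul_eq_two_mul_ncard_edgeSet hL₂
    rw [← Nat.card_eq_fintype_card, Nat.card_coe_set_eq, hE₂] at h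
    rw [← Nat.card_eq_fintype_card, Nat.card_coe_set_eq]
    omega
  have h := eccSpectrum_coneJoin_add hS hC H₁.lineGraph.lineGraph H₂.lineGraph.lineGraph
    (IsRegularOfDegree.lineGraph _ hL₁) (IsRegularOfDegree.lineGraph _ hL₂)
    -- `L²(H)` is 6-regular on `6t` vertices, so it is not complete.
    (hcard₁.trans hcard₂.symm) (by omega)
  refine ⟨fun heq => hne ?_, ?_⟩
  · rw [heq, add_right_inj] at h
    have hinj : Function.Injective fun x : ℝ => -2 * x + -2 := fun x y hxy => by
      simp only at hxy
      linarith
    have h' := Multiset.map_injective hinj h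
    rw [H₁.adjSpectrum_lineGraph_lineGraph hH₁ hV₁ hE₁,
      H₂.adjSpectrum_lineGraph_lineGraph hH₂ hV₂ hE₂, add_left_inj] at h'
    exact (Multiset.map_injective (add_left_injective (3 : ℝ)) h').symm
  · have h' := congrArg (fun s => (s.map fun x : ℝ => |x|).sum) h
    simp only [Multiset.map_add, Multiset.sum_add] at h'
    rw [H₁.sum_abs_adjSpectrum_lineGraph_lineGraph hH₁ hV₁ hE₁,
      H₂.sum_abs_adjSpectrum_lineGraph_lineGraph hH₂ hV₂ hE₂, add_left_inj] at h'
    exact h'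

end SimpleGraph

theorem corollary3p18 {V W₁ W₂ : Type*} [Fintype V] [Nonempty V] [Fintype W₁] [Fintype W₂]
    (G : SimpleGraph V) [DecidableRel G.Adj]
    (H₁ : SimpleGraph W₁) [DecidableRel H₁.Adj] (H₂ : SimpleGraph W₂) [DecidableRel H₂.Adj]
    (t r : ℕ) (ht : 3 ≤ t)
    (hV₁ : Fintype.card W₁ = 2 * t) (hE₁ : H₁.edgeSet.ncard = 3 * t)
    (hV₂ : Fintype.card W₂ = 2 * t) (hE₂ : H₂.edgeSet.ncard = 3 * t)
    (hH₁ : H₁.IsRegularOfDegree 3) (hH₂ : H₂.IsRegularOfDegree 3)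
    (hne : H₁.adjSpectrum ≠ H₂.adjSpectrum)
    (hG : G.IsRegularOfDegree r) (hG₃ : G.CliqueFree 3) :
    ((G.centralVertexJoin H₁.lineGraph.lineGraph).eccSpectrum ≠
        (G.centralVertexJoin H₂.lineGraph.lineGraph).eccSpectrum ∧
      (G.centralVertexJoin H₁.lineGraph.lineGraph).eccEnergy =
        (G.centralVertexJoin H₂.lineGraph.lineGraph).eccEnergy) ∧
    (0 < r →
      (G.centralEdgeJoin H₁.lineGraph.lineGraph).eccSpectrum ≠
        (G.centralEdgeJoin H₂.lineGraph.lineGraph).eccSpectrum ∧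
      (G.centralEdgeJoin H₁.lineGraph.lineGraph).eccEnergy =
        (G.centralEdgeJoin H₂.lineGraph.lineGraph).eccEnergy) := by
  classical
  obtain ⟨v⟩ := ‹Nonempty V›
  simp only [SimpleGraph.centralVertexJoin_eq_coneJoin, SimpleGraph.centralEdgeJoin_eq_coneJoin]
  refine ⟨SimpleGraph.eccSpectrum_ne_and_eccEnergy_eq (S := Set.range Sum.inl)
    ⟨.inl v, v, rfl⟩
    G.cone_centralGraph_range_inl_edist_le H₁ H₂ ht hV₁ hE₁ hV₂ hE₂ hH₁ hH₂ hne, fun hr => ?_⟩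
  have hadj (u : V) : ∃ v, G.Adj u v := (G.degree_pos_iff_exists_adj u).1 ((hG u).symm ▸ hr)
  obtain ⟨w, hw⟩ := hadj v
  exact SimpleGraph.eccSpectrum_ne_and_eccEnergy_eq (S := Set.range Sum.inr)
    ⟨.inr ⟨s(v, w), hw⟩, _, rfl⟩
    (G.cone_centralGraph_range_inr_edist_le hadj) H₁ H₂ ht hV₁ hE₁ hV₂ hE₂ hH₁ hH₂ hne
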